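/- All graphs are finite and simple. In the domination game on a graph $G$, Dominator and Staller alternately choose a vertex of $G$; each chosen vertex must dominate (be equal or adjacent to) at least one vertex not dominated by the previously chosen vertices, and the game ends when all vertices are dominated. Dominator wants as few moves as possible, Staller as many as possible. The game domination number $\gamma_g(G)$ is the number of moves played when Dominator moves first and both play optimally. Let $Z$ be the graph on $\{1,\dots,9\}$ with edges $12, 23, 34, 49, 98, 87, 76, 61, 72, 85, 54, 59, 38$, and let $z=9$. For a graph $H$ with a distinguished vertex $z$ and an integer $k\ge 0$, let $H_k$ be obtained as follows: take the disjoint union of $H$ and the graph $S$ obtained from $K_{1,3}$ with centre $x$ by subdividing one edge; add the edge $xz$; and identify one end vertex of each of $k$ disjoint copies of the path $P_6$ (on six vertices) with $x$. Let $v$ be the vertex of $S$ that is neither $x$ nor adjacent to $x$. Write $Z_k=H_k$ for $H=Z$ and $z=9$, and $W_k=H_k$ for $H=C_6$ and $z$ any of its vertices. (a) For every $\ell\ge 5$ there are a connected graph $G$ and a vertex $v$ of $G$ such that $\gamma_g(G)=\ell$ and $\gamma_g(G-v)=\ell-2$. (b) For every $k\ge 0$, the graph $Z_k$ is connected, $\gamma_g(Z_k)=2k+6$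 and $\gamma_g(Z_k-v)=2k+4$. (c) For every $k\ge 0$, the graph $W_k$ is connected, $\gamma_g(W_k)=2k+5$ and $\gamma_g(W_k-v)=2k+3$. (d) There is no graph $G$ with a vertex $v$ such that $\gamma_g(G)=4$ and $\gamma_g(G-v)=2$, and there is no graph $G$ with a vertex $v$ such that $\gamma_g(G)=3$ and $\gamma_g(G-v)=1$. -/

import Mathlib

namespace DominationGame

/-- The two players of the domination game. -/
inductive Player
  | dominator
  | staller

section Game

variable {V : Type*} [Fintype V] [DecidableEq V] (G : SimpleGraph V) [DecidableRel G.Adj]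

/-- The closed neighbourhood `N[v]`: the set of vertices that `v` dominates. -/
def closedNbhd (v : V) : Finset V :=
  insert v (G.neighborFinset v)

/-- The legal moves when `D` is the set of vertices dominated so far: a chosen vertex has to
dominate at least one vertex outside `D`. -/
def legalMoves (D : Finset V) : Finset V :=
  Finset.univ.filter fun v => ¬ closedNbhd G v ⊆ D

theorem legalMoves_nonempty {D : Finset V} (hD : ¬ D = Finset.univ) :
    (legalMoves G D).Nonempty := by
  obtain ⟨v, hv⟩ : ∃ v, v ∉ D := by
    by_contra h
    push Not at h
    exact hD (Finset.eq_univ_iff_forall.2 h)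
  exact ⟨v, Finset.mem_filter.2 ⟨Finset.mem_univ v,
    fun h => hv (h (Finset.mem_insert_self _ _))⟩⟩

theorem card_compl_lt {D : Finset V} {v : V} (hv : v ∈ legalMoves G D) :
    (D ∪ closedNbhd G v)ᶜ.card < Dᶜ.card := by
  obtain ⟨u, hu, huD⟩ := Finset.not_subset.1 (Finset.mem_filter.1 hv).2
  refine Finset.card_lt_card ((Finset.ssubset_iff_of_subset ?_).2 ⟨u, ?_, ?_⟩)
  · exact Finset.compl_subset_compl.2 Finset.subset_union_left
  · exact Finset.mem_compl.2 huD
  · exact fun h => Finset.mem_compl.1 h (Finset.mem_union_right _ hu)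

/-- The number of moves that are still played, under optimal play, from the position in which
`D` is the set of vertices dominated so far and the given player is to move. The game ends when
all vertices are dominated; Dominator minimizes and Staller maximizes the number of moves. -/
def movesLeft (p : Player) (D : Finset V) : ℕ :=
  if hD : D = Finset.univ then 0
  else
    match p with
    | .dominator =>
      1 + (legalMoves G D).attach.inf' (legalMoves_nonempty G hD).attach
        fun v => movesLeft .staller (D ∪ closedNbhd G v.1)
    | .staller =>
      1 + (legalMoves G D).attach.sup' (legalMoves_nonempty G hD).attach
        fun v => movesLeft .dominator (D ∪ closedNbhd G v.1)
termination_by Dᶜ.card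
decreasing_by
  all_goals exact card_compl_lt G v.2

/-- The game domination number `γ_g(G)`: the number of moves, under optimal play, in the
domination game on `G` in which Dominator moves first. -/
def gameDominationNumber : ℕ :=
  movesLeft G .dominator ∅

end Game

/-- The vertices of the graph `attachTail H z k`. -/
inductive TailVertex (V : Type*) (k : ℕ)
  /-- the vertices of the base graph -/
  | base (p : V)
  /-- the vertex to which everything is attached -/
  | x
  /-- the two leaves adjacent to `x` -/
  | leaf (i : Fin 2)
  /-- the common neighbour of `x` and `v` -/
  | mid
  /-- the vertex at distance two from `x` that is to be removed -/
  | v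
  /-- the vertices, in order and without the end vertex `x`, of `k` copies of the path `P₆` -/
  | path (i : Fin k) (j : Fin 5)
  deriving DecidableEq, Fintype

/-- The edges of `attachTail H z k`, each in at least one direction. -/
def tailRel {V : Type*} (H : SimpleGraph V) (z : V) (k : ℕ) :
    TailVertex V k → TailVertex V k → Prop
  | .base p, .base q => H.Adj p q
  | .base p, .x => p = z
  | .x, .leaf _ => True
  | .x, .mid => True
  | .mid, .v => True
  | .x, .path _ j => j = 0
  | .path i j, .path i' j' => i = i' ∧ j.val + 1 = j'.val
  | _, _ => False

instance {V : Type*} [DecidableEq V] (H : SimpleGraph V) [DecidableRel H.Adj] (z : V) (k : ℕ) :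
    DecidableRel (tailRel H z k) := fun a b => by
  cases a <;> cases b <;> unfold tailRel <;> infer_instance

/-- Take the disjoint union of `H` and the star `K_{1,3}` with centre `x` in which one edge is
subdivided (`v` being its vertex outside `N[x]`), join `z` and `x` by an edge, and identify one
end vertex of each of `k` copies of the path `P₆` with `x`. -/
def attachTail {V : Type*} (H : SimpleGraph V) (z : V) (k : ℕ) : SimpleGraph (TailVertex V k) :=
  SimpleGraph.fromRel (tailRel H z k)

instance {V : Type*} [DecidableEq V] (H : SimpleGraph V) [DecidableRel H.Adj] (z : V) (k : ℕ) :
    DecidableRel (attachTail H z k).Adj :=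
  inferInstanceAs (DecidableRel (SimpleGraph.fromRel (tailRel H z k)).Adj)

/-- The edges of the nine-vertex graph `graphZ`, each in one direction. -/
def edgesZ : List (Fin 9 × Fin 9) :=
  [(0, 1), (1, 2), (2, 3), (3, 8), (8, 7), (7, 6), (6, 5), (5, 0),
   (6, 1), (7, 4), (4, 3), (4, 8), (2, 7)]

/-- The nine-vertex graph `Z`; its distinguished vertex `z` is `8`. -/
def graphZ : SimpleGraph (Fin 9) :=
  SimpleGraph.fromRel fun a b => (a, b) ∈ edgesZ

instance : DecidableRel graphZ.Adj :=
  inferInstanceAs (DecidableRel (SimpleGraph.fromRel fun a b => (a, b) ∈ edgesZ).Adj)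

/-- The graph `Z_k`. -/
def familyZ (k : ℕ) : SimpleGraph (TailVertex (Fin 9) k) :=
  attachTail graphZ 8 k

instance (k : ℕ) : DecidableRel (familyZ k).Adj :=
  inferInstanceAs (DecidableRel (attachTail graphZ 8 k).Adj)

/-- The graph `W_k`: as `Z_k`, with the cycle `C₆` in place of `Z`. -/
def familyW (k : ℕ) : SimpleGraph (TailVertex (Fin 6) k) :=
  attachTail (SimpleGraph.cycleGraph 6) 0 k

instance (k : ℕ) : DecidableRel (familyW k).Adj :=
  inferInstanceAs (DecidableRel (attachTail (SimpleGraph.cycleGraph 6) 0 k).Adj)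

end DominationGame

/-! Call `x` together with everything off the attached paths the core. A pendant path of five
vertices, of which only the first is dominated and has its outside neighbours dominated, is neutral:
no move finishes it, every move on it has a reply that finishes it, and either player can give that
reply. By induction it adds exactly two moves, whoever is to move (`movesLeft_pendantPath`).

At the start `x` is not yet dominated, so the value is squeezed (`gameDominationNumber_pathBundle`).
Above: Dominator opens with `x`, which brings all `k` paths into the neutral state. Below: by the
Continuation Principle (`movesLeft_anti`), declaring `x` and the first path vertices dominated does
not lengthen the game. Both bounds become `2 * k` plus a value on the core, independent of `k`.
These finite games are evaluated on bit masks, and the bounds agree in all four cases.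

After the move `x`, the vertex `v` is the only undominated vertex of the core outside the base
graph. It takes one extra move, which also shifts the turn; for both base graphs the net effect is
two moves.

The pairs `(4, 2)` and `(3, 1)` are excluded by letting Dominator open in `G` with an optimal first
move of `G - v`. -/

namespace DominationGame

/-! ### Recursion for the game value and the Continuation Principle. -/

section General

variable {V : Type*} [Fintype V] [DecidableEq V] (G : SimpleGraph V) [DecidableRel G.Adj]

theorem mem_closedNbhd {u v : V} : u ∈ closedNbhd G v ↔ u = v ∨ G.Adj v u := by
  simp [closedNbhd]

theorem self_mem_closedNbhd (v : V) : v ∈ closedNbhd G v :=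
  (mem_closedNbhd G).2 (Or.inl rfl)

theorem mem_legalMoves {v : V} {D : Finset V} :
    v ∈ legalMoves G D ↔ ¬ closedNbhd G v ⊆ D := by
  simp [legalMoves]

theorem movesLeft_univ (p : Player) : movesLeft G p Finset.univ = 0 := by
  rw [movesLeft]; simp

theorem movesLeft_dominator_le_iff {D : Finset V} (hD : D ≠ Finset.univ) (n : ℕ) :
    movesLeft G .dominator D ≤ n + 1 ↔
      ∃ v ∈ legalMoves G D, movesLeft G .staller (D ∪ closedNbhd G v) ≤ n := by
  rw [movesLeft, dif_neg hD]
  dsimp only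
  rw [add_comm, Nat.add_le_add_iff_right, Finset.inf'_le_iff]
  simp

theorem movesLeft_staller_le_iff {D : Finset V} (hD : D ≠ Finset.univ) (n : ℕ) :
    movesLeft G .staller D ≤ n + 1 ↔
      ∀ v ∈ legalMoves G D, movesLeft G .dominator (D ∪ closedNbhd G v) ≤ n := by
  rw [movesLeft, dif_neg hD]
  dsimp only
  rw [add_comm, Nat.add_le_add_iff_right, Finset.sup'_le_iff]
  simp

theorem movesLeft_pos {D : Finset V} (hD : D ≠ Finset.univ) (p : Player) :
    0 < movesLeft G p D := by
  rw [movesLeft, dif_neg hD]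
  cases p <;> simp

theorem movesLeft_eq_zero_iff {D : Finset V} {p : Player} :
    movesLeft G p D = 0 ↔ D = Finset.univ := by
  constructor
  · intro h
    by_contra hD
    exact (movesLeft_pos G hD p).ne' h
  · rintro rfl
    exact movesLeft_univ G p

theorem exists_movesLeft_dominator {D : Finset V} (hD : D ≠ Finset.univ) :
    ∃ v ∈ legalMoves G D,
      movesLeft G .dominator D = movesLeft G .staller (D ∪ closedNbhd G v) + 1 := by
  obtain ⟨n, hn⟩ := Nat.exists_eq_succ_of_ne_zero (movesLeft_pos G hD .dominator).ne'
  obtain ⟨v, hv, hle⟩ := (movesLeft_dominator_le_iff G hD n).1 hn.le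
  refine ⟨v, hv, le_antisymm ((movesLeft_dominator_le_iff G hD _).2 ⟨v, hv, le_rfl⟩) ?_⟩
  omega

theorem movesLeft_dominator_le {D : Finset V} {v : V} (hv : v ∈ legalMoves G D) :
    movesLeft G .dominator D ≤ movesLeft G .staller (D ∪ closedNbhd G v) + 1 := by
  refine (movesLeft_dominator_le_iff G ?_ _).2 ⟨v, hv, le_rfl⟩
  rintro rfl
  exact (mem_legalMoves G).1 hv (Finset.subset_univ _)

theorem le_movesLeft_staller {D : Finset V} {v : V} (hv : v ∈ legalMoves G D) :
    movesLeft G .dominator (D ∪ closedNbhd G v) + 1 ≤ movesLeft G .staller D := by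
  have hD : D ≠ Finset.univ := by
    rintro rfl
    exact (mem_legalMoves G).1 hv (Finset.subset_univ _)
  obtain ⟨n, hn⟩ := Nat.exists_eq_succ_of_ne_zero (movesLeft_pos G hD .staller).ne'
  have := (movesLeft_staller_le_iff G hD n).1 hn.le v hv
  omega

theorem exists_movesLeft_staller {D : Finset V} (hD : D ≠ Finset.univ) :
    ∃ v ∈ legalMoves G D,
      movesLeft G .staller D = movesLeft G .dominator (D ∪ closedNbhd G v) + 1 := by
  by_contra! h
  obtain ⟨n, hn⟩ := Nat.exists_eq_succ_of_ne_zero (movesLeft_pos G hD .staller).ne'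
  obtain ⟨u, hu⟩ := legalMoves_nonempty G hD
  have h0 : ∀ v ∈ legalMoves G D, movesLeft G .dominator (D ∪ closedNbhd G v) < n := by
    intro v hv
    have h1 := h v hv
    have h2 := le_movesLeft_staller G hv
    omega
  have := (movesLeft_staller_le_iff G hD (n - 1)).2 fun v hv => by
    have := h0 v hv
    omega
  have := h0 u hu
  omega

/-- The Continuation Principle. -/
theorem movesLeft_anti {D D' : Finset V} (h : D' ⊆ D) (p : Player) :
    movesLeft G p D ≤ movesLeft G p D' := by
  induction hn : D'ᶜ.card using Nat.strong_induction_on generalizing D D' p with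
  | _ n ih =>
    subst hn
    by_cases hD : D = Finset.univ
    · simp [hD, movesLeft_univ]
    have hD' : D' ≠ Finset.univ := by
      rintro rfl
      exact hD (Finset.univ_subset_iff.1 h)
    cases p with
    | dominator =>
      obtain ⟨w, hw, hval⟩ := exists_movesLeft_dominator G hD'
      -- Dominator copies `w`. If `w` is illegal at `D`, its neighbourhood already lies in `D`, so
      -- any legal move will do.
      have key : ∃ u ∈ legalMoves G D, D' ∪ closedNbhd G w ⊆ D ∪ closedNbhd G u := by
        by_cases hl : w ∈ legalMoves G D
        · exact ⟨w, hl, Finset.union_subset_union_left h⟩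
        · obtain ⟨u, hu⟩ := legalMoves_nonempty G hD
          rw [mem_legalMoves, not_not] at hl
          exact ⟨u, hu, (Finset.union_subset h hl).trans Finset.subset_union_left⟩
      obtain ⟨u, hu, hsub⟩ := key
      rw [hval]
      exact (movesLeft_dominator_le G hu).trans
        (Nat.succ_le_succ (ih _ (card_compl_lt G hw) hsub _ rfl))
    | staller =>
      obtain ⟨u, hu, hval⟩ := exists_movesLeft_staller G hD
      have hu' : u ∈ legalMoves G D' :=
        (mem_legalMoves G).2 fun hs => (mem_legalMoves G).1 hu (hs.trans h)
      rw [hval]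
      exact (Nat.succ_le_succ
        (ih _ (card_compl_lt G hu') (Finset.union_subset_union_left h) _ rfl)).trans
        (le_movesLeft_staller G hu')

/-- If every move from a position ends the game, exactly one move is played. -/
theorem movesLeft_eq_one {D : Finset V} (hD : D ≠ Finset.univ)
    (h : ∀ v ∈ legalMoves G D, D ∪ closedNbhd G v = Finset.univ) (p : Player) :
    movesLeft G p D = 1 := by
  cases p with
  | dominator =>
    obtain ⟨v, hv, hval⟩ := exists_movesLeft_dominator G hD
    rw [hval, h v hv, movesLeft_univ]
  | staller =>
    obtain ⟨v, hv, hval⟩ := exists_movesLeft_staller G hD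
    rw [hval, h v hv, movesLeft_univ]

/-- The position is one move of Dominator away from the end. -/
theorem movesLeft_dominator_le_one {D : Finset V} {v : V}
    (h : D ∪ closedNbhd G v = Finset.univ) : movesLeft G .dominator D ≤ 1 := by
  by_cases hD : D = Finset.univ
  · simp [hD, movesLeft_univ]
  have hv : v ∈ legalMoves G D := by
    rw [mem_legalMoves]
    intro hs
    rw [Finset.union_eq_left.2 hs] at h
    exact hD h
  have := movesLeft_dominator_le G hv
  rwa [h, movesLeft_univ] at this

end General

/-! ### Pendant paths are worth exactly two moves. -/

section PendantPath

variable {V : Type*} [Fintype V] [DecidableEq V] (G : SimpleGraph V) [DecidableRel G.Adj]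

/-- The move answering `j` on a path `0, …, 4` on which `1, 2, 3, 4` are undominated. -/
def pathReply : Fin 5 → Fin 5 := ![3, 4, 4, 0, 1]

/-- Vertex `0` is exempt because it is already dominated when the reply is used. -/
theorem pathReply_covers : ∀ i j : Fin 5, i ≠ 0 →
    (i = j ∨ i.val + 1 = j.val ∨ j.val + 1 = i.val) ∨
      (i = pathReply j ∨ i.val + 1 = (pathReply j).val ∨ (pathReply j).val + 1 = i.val) := by
  decide

/-- A pendant path whose first vertex is the only dominated one contributes exactly two moves. -/
theorem movesLeft_pendantPath {p : Fin 5 → V}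
    (hp : ∀ i j, p i ∈ closedNbhd G (p j) ↔ i = j ∨ i.val + 1 = j.val ∨ j.val + 1 = i.val)
    (hout : ∀ w, w ∉ Set.range p → ∀ j, j ≠ 0 → p j ∉ closedNbhd G w)
    {D : Finset V} (hD : ∀ j w, w ∈ closedNbhd G (p j) → w ∉ Set.range p → w ∈ D)
    (h0 : p 0 ∈ D) (h1 : ∀ j, j ≠ 0 → p j ∉ D) (pl : Player) :
    movesLeft G pl D = movesLeft G pl (D ∪ Finset.univ.image p) + 2 := by
  induction hn : Dᶜ.card using Nat.strong_induction_on generalizing D pl with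
  | _ n ih =>
    subst hn
    set T := Finset.univ.image p with hT
    have memT : ∀ j, p j ∈ T := fun j => Finset.mem_image_of_mem _ (Finset.mem_univ j)
    have range_or (w : V) : w ∉ Set.range p ∨ ∃ j, w = p j := by
      by_cases hw : w ∈ Set.range p
      · obtain ⟨j, rfl⟩ := hw
        exact Or.inr ⟨j, rfl⟩
      · exact Or.inl hw
    have notMemT : ∀ w, w ∉ Set.range p → w ∉ T := by
      intro w hw h
      obtain ⟨j, -, rfl⟩ := Finset.mem_image.1 h
      exact hw ⟨j, rfl⟩
    have nbhd_sub : ∀ j, closedNbhd G (p j) ⊆ D ∪ T := by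
      intro j w hw
      rcases range_or w with h | ⟨i, rfl⟩
      · exact Finset.mem_union_left _ (hD j w hw h)
      · exact Finset.mem_union_right _ (memT i)
    have reply : ∀ j, (D ∪ closedNbhd G (p j)) ∪ closedNbhd G (p (pathReply j)) = D ∪ T := by
      intro j
      refine Finset.Subset.antisymm (Finset.union_subset (Finset.union_subset
        Finset.subset_union_left (nbhd_sub j)) (nbhd_sub _)) (Finset.union_subset
        (Finset.subset_union_left.trans Finset.subset_union_left) ?_)
      intro w hw
      obtain ⟨i, -, rfl⟩ := Finset.mem_image.1 hw
      by_cases hi : i = 0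
      · subst hi
        exact Finset.mem_union_left _ (Finset.mem_union_left _ h0)
      · simp only [Finset.mem_union, hp]
        exact (pathReply_covers i j hi).imp_left Or.inr
    -- Four path vertices are undominated, and one move dominates at most three of them.
    have missed : ∀ w, ∃ i, p i ∉ D ∪ closedNbhd G w := by
      intro w
      rcases range_or w with h | ⟨j, rfl⟩
      · exact ⟨1, by simp [h1 1 (by decide), hout w h 1 (by decide)]⟩
      · obtain ⟨i, hi, hij⟩ : ∃ i : Fin 5, i ≠ 0 ∧
            ¬(i = j ∨ i.val + 1 = j.val ∨ j.val + 1 = i.val) := by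
          clear * -
          revert j
          decide
        exact ⟨i, by simp only [Finset.mem_union, hp, h1 i hi, hij, or_self, not_false_eq_true]⟩
    have not_over : ∀ w, D ∪ closedNbhd G w ≠ Finset.univ := by
      intro w h
      obtain ⟨i, hi⟩ := missed w
      exact hi (h ▸ Finset.mem_univ _)
    have hDu : D ≠ Finset.univ := fun h => h1 1 (by decide) (h ▸ Finset.mem_univ _)
    have legal_p : ∀ j, p j ∈ legalMoves G D := by
      intro j
      rw [mem_legalMoves]
      intro hs
      obtain ⟨i, hi, hij⟩ : ∃ i : Fin 5, i ≠ 0 ∧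
          (i = j ∨ i.val + 1 = j.val ∨ j.val + 1 = i.val) := by
        clear * -
        revert j
        decide
      exact h1 i hi (hs ((hp i j).2 hij))
    have legal_reply : ∀ j, p (pathReply j) ∈ legalMoves G (D ∪ closedNbhd G (p j)) := by
      intro j
      rw [mem_legalMoves]
      intro hs
      have := reply j
      rw [Finset.union_eq_left.2 hs] at this
      obtain ⟨i, hi⟩ := missed (p j)
      exact hi (this ▸ Finset.mem_union_right _ (memT i))
    have legal_iff : ∀ w, w ∉ Set.range p →
        (w ∈ legalMoves G D ↔ w ∈ legalMoves G (D ∪ T)) := by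
      intro w hw
      rw [mem_legalMoves, mem_legalMoves, not_iff_not]
      refine ⟨fun h => h.trans Finset.subset_union_left, fun h u hu => ?_⟩
      rcases range_or u with hur | ⟨j, rfl⟩
      · exact (Finset.mem_union.1 (h hu)).resolve_right (notMemT u hur)
      · by_cases hj : j = 0
        · rwa [hj]
        · exact absurd hu (hout w hw j hj)
    have off_path : ∀ w, w ∈ legalMoves G (D ∪ T) → w ∉ Set.range p := by
      rintro w hw ⟨j, rfl⟩
      exact (mem_legalMoves G).1 hw (nbhd_sub j)
    -- A move off the path leaves `1, …, 4` untouched, so the induction hypothesis applies after it.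
    have step : ∀ w, w ∉ Set.range p → w ∈ legalMoves G D → ∀ pl,
        movesLeft G pl (D ∪ closedNbhd G w) = movesLeft G pl (D ∪ T ∪ closedNbhd G w) + 2 := by
      intro w hw hl pl
      rw [Finset.union_right_comm]
      refine ih _ (card_compl_lt G hl) (fun j u hu hur => Finset.mem_union_left _ (hD j u hu hur))
        (Finset.mem_union_left _ h0) (fun j hj h => ?_) pl rfl
      exact (Finset.mem_union.1 h).elim (h1 j hj) (hout w hw j hj)
    -- If the rest is finished, the mover has no off-path move to copy, and the value two is checked
    -- directly. Otherwise one inequality comes from the mover's optimal move in the rest, the other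
    -- from answering path moves by `pathReply`.
    by_cases hover : D ∪ T = Finset.univ
    · rw [hover, movesLeft_univ]
      cases pl with
      | dominator =>
        refine le_antisymm ?_ ?_
        -- Playing `p 3` leaves only `p 1` undominated, so Staller cannot prolong the game beyond
        -- one more move.
        · refine (movesLeft_dominator_le G (legal_p 3)).trans (Nat.succ_le_succ ?_)
          refine (movesLeft_eq_one G (not_over _) (fun v hv => ?_) _).le
          rw [mem_legalMoves, Finset.not_subset] at hv
          obtain ⟨u, hu, hu'⟩ := hv
          have only : ∀ u, u ∉ D ∪ closedNbhd G (p 3) → u = p 1 := by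
            intro u hu
            have : u ∈ D ∪ T := hover ▸ Finset.mem_univ u
            rcases Finset.mem_union.1 this with h | h
            · exact absurd (Finset.mem_union_left _ h) hu
            · obtain ⟨i, -, rfl⟩ := Finset.mem_image.1 h
              by_cases hi : i = 0
              · subst hi
                exact absurd (Finset.mem_union_left _ h0) hu
              · simp only [Finset.mem_union, h1 i hi, hp, false_or] at hu
                congr 1
                clear * - hu hi
                revert i
                decide
          refine Finset.eq_univ_iff_forall.2 fun w => ?_
          by_cases hw : w ∈ D ∪ closedNbhd G (p 3)
          · exact Finset.mem_union_left _ hw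
          · rw [only w hw, ← only u hu']
            exact Finset.mem_union_right _ hu
        · obtain ⟨v, hv, hval⟩ := exists_movesLeft_dominator G hDu
          have := movesLeft_pos G (not_over v) .staller
          omega
      | staller =>
        obtain ⟨v, hv, hval⟩ := exists_movesLeft_staller G hDu
        have hpos := movesLeft_pos G (not_over v) .dominator
        have hle : movesLeft G .dominator (D ∪ closedNbhd G v) ≤ 1 := by
          rcases range_or v with h | ⟨j, rfl⟩
          · rw [legal_iff v h, hover, mem_legalMoves] at hv
            exact absurd (Finset.subset_univ _) hv
          · exact movesLeft_dominator_le_one G ((reply j).trans hover)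
        omega
    · cases pl with
      | dominator =>
        refine le_antisymm ?_ ?_
        · obtain ⟨w, hw, hval⟩ := exists_movesLeft_dominator G hover
          have hwp := off_path w hw
          have hl := (legal_iff w hwp).2 hw
          have := movesLeft_dominator_le G hl
          rw [step w hwp hl] at this
          omega
        · obtain ⟨v, hv, hval⟩ := exists_movesLeft_dominator G hDu
          rcases range_or v with h | ⟨j, rfl⟩
          · rw [step v h hv] at hval
            have := movesLeft_dominator_le G ((legal_iff v h).1 hv)
            omega
          · have := le_movesLeft_staller G (legal_reply j)
            rw [reply j] at this
            omega
      | staller =>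
        refine le_antisymm ?_ ?_
        · obtain ⟨v, hv, hval⟩ := exists_movesLeft_staller G hDu
          rcases range_or v with h | ⟨j, rfl⟩
          · rw [step v h hv] at hval
            have := le_movesLeft_staller G ((legal_iff v h).1 hv)
            omega
          · have := movesLeft_dominator_le G (legal_reply j)
            rw [reply j] at this
            omega
        · obtain ⟨w, hw, hval⟩ := exists_movesLeft_staller G hover
          have hwp := off_path w hw
          have hl := (legal_iff w hwp).2 hw
          have := le_movesLeft_staller G hl
          rw [step w hwp hl] at this
          omega

end PendantPath

end DominationGame

namespace DominationGame

/-! ### Evaluating finite positions by bit masks. -/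

section Masks

/-- Whether at most `n` moves remain, in the game in which positions are bit masks, `full` is the
final position and `L` lists the closed neighbourhoods. -/
def maskLe (L : List ℕ) (full : ℕ) : ℕ → Player → ℕ → Bool
  | 0, _, M => M == full
  | n + 1, .dominator, M =>
    M == full || L.any fun m => (M ||| m != M) && maskLe L full n .staller (M ||| m)
  | n + 1, .staller, M =>
    M == full || L.all fun m => (M ||| m == M) || maskLe L full n .dominator (M ||| m)

variable {V : Type*} [Fintype V] [DecidableEq V] (G : SimpleGraph V) [DecidableRel G.Adj]

/-- The domination game, played on the vertices `q i` once all others are dominated, is the game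
on bit masks. -/
theorem movesLeft_le_iff_maskLe {n : ℕ} (q : Fin n → V) (N : Fin n → ℕ)
    (hN : ∀ i j : Fin n, (N i).testBit j = true ↔ q j ∈ closedNbhd G (q i))
    (hlt : ∀ i, N i < 2 ^ n) (m : ℕ) {D : Finset V} {M : ℕ}
    (hM : ∀ i : Fin n, M.testBit i = true ↔ q i ∈ D) (hMlt : M < 2 ^ n)
    (hout : ∀ w, w ∉ Set.range q → closedNbhd G w ⊆ D) (p : Player) :
    movesLeft G p D ≤ m ↔ maskLe (List.ofFn N) (2 ^ n - 1) m p M = true := by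
  have hfull : ∀ {D : Finset V} {M : ℕ}, (∀ i : Fin n, M.testBit i = true ↔ q i ∈ D) →
      M < 2 ^ n → (∀ w, w ∉ Set.range q → closedNbhd G w ⊆ D) →
      (M = 2 ^ n - 1 ↔ D = Finset.univ) := by
    intro D M hM hMlt hout
    constructor
    · intro h
      refine Finset.eq_univ_iff_forall.2 fun w => ?_
      by_cases hw : w ∈ Set.range q
      · obtain ⟨i, rfl⟩ := hw
        rw [← hM, h, Nat.testBit_two_pow_sub_one]
        simp
      · exact hout w hw (self_mem_closedNbhd G w)
    · intro h
      refine Nat.eq_of_testBit_eq fun i => ?_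
      rw [Nat.testBit_two_pow_sub_one]
      by_cases hi : i < n
      · simp [hi, (hM ⟨i, hi⟩).2 (h ▸ Finset.mem_univ _)]
      · rw [Nat.testBit_lt_two_pow (hMlt.trans_le (Nat.pow_le_pow_right two_pos (not_lt.1 hi)))]
        simp [hi]
  have hstep : ∀ {D : Finset V} {M : ℕ} (i : Fin n),
      (∀ i : Fin n, M.testBit i = true ↔ q i ∈ D) →
      ∀ j : Fin n, (M ||| N i).testBit j = true ↔ q j ∈ D ∪ closedNbhd G (q i) := by
    intro D M i hM j
    rw [Nat.testBit_or, Bool.or_eq_true, hM, hN, Finset.mem_union]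
  have hlegal : ∀ {D : Finset V} {M : ℕ} (i : Fin n),
      (∀ i : Fin n, M.testBit i = true ↔ q i ∈ D) → M < 2 ^ n →
      (∀ w, w ∉ Set.range q → closedNbhd G w ⊆ D) →
      (M ||| N i ≠ M ↔ q i ∈ legalMoves G D) := by
    intro D M i hM hMlt hout
    rw [mem_legalMoves, not_iff_not, ← Finset.union_eq_left]
    constructor
    · intro h
      ext w
      by_cases hw : w ∈ Set.range q
      · obtain ⟨j, rfl⟩ := hw
        rw [← hstep i hM, h, hM]
      · have := hout w hw (self_mem_closedNbhd G w)
        simp [this]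
    · intro h
      refine Nat.eq_of_testBit_eq fun j => ?_
      by_cases hj : j < n
      · have := hstep i hM ⟨j, hj⟩
        rw [h, ← hM] at this
        exact Bool.eq_iff_iff.2 this
      · have hle := Nat.pow_le_pow_right two_pos (not_lt.1 hj)
        rw [Nat.testBit_lt_two_pow (hMlt.trans_le hle),
          Nat.testBit_lt_two_pow ((Nat.or_lt_two_pow hMlt (hlt i)).trans_le hle)]
  induction m generalizing D M p with
  | zero =>
    rw [Nat.le_zero, movesLeft_eq_zero_iff, ← hfull hM hMlt hout]
    simp [maskLe]
  | succ m ih =>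
    have ih' : ∀ i p, movesLeft G p (D ∪ closedNbhd G (q i)) ≤ m ↔
        maskLe (List.ofFn N) (2 ^ n - 1) m p (M ||| N i) = true := fun i p =>
      ih (hstep i hM) (Nat.or_lt_two_pow hMlt (hlt i))
        (fun w hw => (hout w hw).trans Finset.subset_union_left) p
    by_cases hD : D = Finset.univ
    · have := (hfull hM hMlt hout).2 hD
      rw [hD, movesLeft_univ]
      cases p <;> simp [maskLe, this]
    have hMf : M ≠ 2 ^ n - 1 := fun h => hD ((hfull hM hMlt hout).1 h)
    -- The other vertices have fully dominated neighbourhoods, so every legal move is some `q i`.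
    have hrange : ∀ v ∈ legalMoves G D, ∃ i, q i = v := by
      intro v hv
      by_contra hw
      exact (mem_legalMoves G).1 hv (hout v hw)
    cases p with
    | dominator =>
      rw [movesLeft_dominator_le_iff G hD]
      simp only [maskLe, Bool.or_eq_true, beq_iff_eq, hMf, false_or, List.any_eq_true,
        List.mem_ofFn, Bool.and_eq_true, bne_iff_ne, exists_exists_eq_and, ← ih',
        hlegal _ hM hMlt hout]
      constructor
      · rintro ⟨v, hv, h⟩
        obtain ⟨i, rfl⟩ := hrange v hv
        exact ⟨i, hv, h⟩
      · rintro ⟨i, hv, h⟩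
        exact ⟨_, hv, h⟩
    | staller =>
      rw [movesLeft_staller_le_iff G hD]
      simp only [maskLe, Bool.or_eq_true, beq_iff_eq, hMf, false_or, List.all_eq_true,
        List.mem_ofFn, forall_exists_index, forall_apply_eq_imp_iff, ← ih']
      constructor
      · intro h i
        by_cases hi : M ||| N i = M
        · exact Or.inl hi
        · exact Or.inr (h _ ((hlegal i hM hMlt hout).1 hi))
      · intro h v hv
        obtain ⟨i, rfl⟩ := hrange v hv
        exact (h i).resolve_left ((hlegal i hM hMlt hout).2 hv)

end Masks

/-! ### Splitting off all pendant paths. -/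

section PathBundle

variable {V : Type*} [Fintype V] [DecidableEq V] (G : SimpleGraph V) [DecidableRel G.Adj]
  {n k : ℕ} {q : Fin n → V} {p : Fin k → Fin 5 → V} {c : Fin n}

/-- `k` pendant paths whose first vertices are the only dominated ones contribute exactly
`2 * k` moves. -/
theorem movesLeft_pathBundle
    (hcover : ∀ w, (∃ i, w = q i) ∨ ∃ a j, w = p a j)
    (hpp : ∀ a j a' j', p a j ∈ closedNbhd G (p a' j') ↔
      a = a' ∧ (j = j' ∨ j.val + 1 = j'.val ∨ j'.val + 1 = j.val))
    (hpq : ∀ i a j, p a j ∈ closedNbhd G (q i) ↔ i = c ∧ j = 0)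
    {D : Finset V} (hc : q c ∈ D) (h0 : ∀ a, p a 0 ∈ D) (h1 : ∀ a j, j ≠ 0 → p a j ∉ D)
    (pl : Player) (A : Finset (Fin k)) :
    movesLeft G pl D =
      movesLeft G pl (D ∪ A.biUnion fun a => Finset.univ.image (p a)) + 2 * A.card := by
  have hinj : ∀ {a j a' j'}, p a j = p a' j' → a = a' ∧
      (j = j' ∨ j.val + 1 = j'.val ∨ j'.val + 1 = j.val) := by
    intro a j a' j' h
    exact (hpp a j a' j').1 (h ▸ self_mem_closedNbhd G _)
  induction A using Finset.induction_on with
  | empty => simp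
  | insert a A ha ih =>
    rw [ih, Finset.card_insert_of_notMem ha, Finset.biUnion_insert,
      Finset.union_comm (Finset.univ.image (p a)), ← Finset.union_assoc,
      movesLeft_pendantPath G (p := p a) (D := D ∪ A.biUnion fun a => Finset.univ.image (p a))]
    · ring
    · intro i j
      simp [hpp]
    · intro w hw j hj h
      rcases hcover w with ⟨i, rfl⟩ | ⟨b, i, rfl⟩
      · exact hj ((hpq _ _ _).1 h).2
      · obtain rfl := ((hpp _ _ _ _).1 h).1
        exact hw ⟨i, rfl⟩
    · intro j w hw hwr
      rcases hcover w with ⟨i, rfl⟩ | ⟨b, i, rfl⟩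
      · have hs : p a j ∈ closedNbhd G (q i) := by
          rw [mem_closedNbhd] at hw ⊢
          exact hw.imp Eq.symm fun h => h.symm
        rw [((hpq _ _ _).1 hs).1]
        exact Finset.mem_union_left _ hc
      · obtain rfl := ((hpp _ _ _ _).1 hw).1
        exact absurd ⟨i, rfl⟩ hwr
    · exact Finset.mem_union_left _ (h0 a)
    · intro j hj h
      rcases Finset.mem_union.1 h with h | h
      · exact h1 a j hj h
      · obtain ⟨b, hb, h⟩ := Finset.mem_biUnion.1 h
        obtain ⟨i, -, h⟩ := Finset.mem_image.1 h
        exact ha ((hinj h).1 ▸ hb)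

/-- The game on a graph that consists of vertices `q i` and of `k` paths attached to `q c`: if
Dominator has a good first move `q c` in the game without the paths, and this game does not
get shorter when `q c` is dominated beforehand, then the paths contribute `2 * k` moves. -/
theorem gameDominationNumber_pathBundle
    (hcover : ∀ w, (∃ i, w = q i) ∨ ∃ a j, w = p a j)
    (hpp : ∀ a j a' j', p a j ∈ closedNbhd G (p a' j') ↔
      a = a' ∧ (j = j' ∨ j.val + 1 = j'.val ∨ j'.val + 1 = j.val))
    (hpq : ∀ i a j, p a j ∈ closedNbhd G (q i) ↔ i = c ∧ j = 0)
    (N : Fin n → ℕ) (hN : ∀ i j : Fin n, (N i).testBit j = true ↔ q j ∈ closedNbhd G (q i))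
    (hlt : ∀ i, N i < 2 ^ n) (hq : Function.Injective q) {t : ℕ}
    (hle : maskLe (List.ofFn N) (2 ^ n - 1) t .staller (N c) = true)
    (hge : maskLe (List.ofFn N) (2 ^ n - 1) t .dominator (2 ^ c.val) = false) :
    gameDominationNumber G = 2 * k + (t + 1) := by
  set P : Finset V := Finset.univ.biUnion fun a => Finset.univ.image (p a) with hP
  have memP : ∀ a j, p a j ∈ P := fun a j => Finset.mem_biUnion.2
    ⟨a, Finset.mem_univ a, Finset.mem_image_of_mem _ (Finset.mem_univ j)⟩
  -- A common vertex would be a first path vertex, and would then dominate `p a 1`, which no `q i`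
  -- does.
  have hqp : ∀ i a j, q i ≠ p a j := by
    intro i a j h
    have h2 := ((hpq i a j).1 (h ▸ self_mem_closedNbhd G _)).2
    have h3 : p a 1 ∈ closedNbhd G (q i) := by
      rw [h, hpp, h2]
      simp
    exact absurd ((hpq _ _ _).1 h3).2 (by decide)
  have notMemP : ∀ i, q i ∉ P := by
    intro i h
    obtain ⟨a, -, h⟩ := Finset.mem_biUnion.1 h
    obtain ⟨j, -, h⟩ := Finset.mem_image.1 h
    exact hqp i a j h.symm
  have hout : ∀ D : Finset V, q c ∈ D → ∀ w, w ∉ Set.range q → closedNbhd G w ⊆ D ∪ P := by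
    intro D hc w hw u hu
    rcases hcover w with ⟨i, rfl⟩ | ⟨a, j, rfl⟩
    · exact absurd ⟨i, rfl⟩ hw
    · rcases hcover u with ⟨i, rfl⟩ | ⟨b, i, rfl⟩
      · have hs : p a j ∈ closedNbhd G (q i) := by
          rw [mem_closedNbhd] at hu ⊢
          exact hu.imp Eq.symm fun h => h.symm
        rw [((hpq _ _ _).1 hs).1]
        exact Finset.mem_union_left _ hc
      · exact Finset.mem_union_right _ (memP b i)
  have card : (Finset.univ : Finset (Fin k)).card = k := by simp
  apply le_antisymm
  -- Upper bound: Dominator opens with `q c`.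
  · have hself := self_mem_closedNbhd G (q c)
    have hlegal : q c ∈ legalMoves G ∅ :=
      (mem_legalMoves G).2 fun h => absurd (h hself) (Finset.notMem_empty _)
    refine (movesLeft_dominator_le G hlegal).trans ?_
    rw [Finset.empty_union, movesLeft_pathBundle G hcover hpp hpq hself
      (fun a => (hpq _ _ _).2 ⟨rfl, rfl⟩) (fun a j hj h => hj ((hpq _ _ _).1 h).2) _
      Finset.univ, card]
    have := (movesLeft_le_iff_maskLe G q N hN hlt t (D := closedNbhd G (q c) ∪ P) (M := N c)
      (fun i => by simp [hN, notMemP]) (hlt c) (hout _ hself) .staller).2 hle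
    rw [hP] at this
    omega
  -- Lower bound: `q c` and all `p a 0` are dominated for free, so the core starts from the single
  -- bit `2 ^ c`.
  · set D : Finset V := insert (q c) (Finset.univ.image fun a => p a 0) with hD
    have hself : q c ∈ D := Finset.mem_insert_self _ _
    have hmem : ∀ i, q i ∈ D ∪ P ↔ i = c := by
      intro i
      simp [hD, notMemP, fun a => (hqp i a 0).symm, hq.eq_iff]
    have h1 : ∀ a j, j ≠ 0 → p a j ∉ D := by
      intro a j hj h
      rcases Finset.mem_insert.1 h with h | h
      · exact hqp _ _ _ h.symm
      · obtain ⟨b, -, h⟩ := Finset.mem_image.1 h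
        have hs : p a j ∈ closedNbhd G (q c) := h ▸ (hpq c b 0).2 ⟨rfl, rfl⟩
        exact hj ((hpq _ _ _).1 hs).2
    refine le_trans ?_ (movesLeft_anti G (Finset.empty_subset D) .dominator)
    rw [movesLeft_pathBundle G hcover hpp hpq hself
      (fun a => Finset.mem_insert_of_mem (Finset.mem_image_of_mem _ (Finset.mem_univ a))) h1 _
      Finset.univ, card]
    have := mt (movesLeft_le_iff_maskLe G q N hN hlt t (D := D ∪ P) (M := 2 ^ c.val)
      (fun i => by rw [hmem, Nat.testBit_two_pow]; simp [Fin.ext_iff, eq_comm])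
      (Nat.pow_lt_pow_right one_lt_two c.2) (hout _ hself) .dominator).1
      (by simp [hge])
    rw [hP] at this
    omega

end PathBundle

end DominationGame

namespace DominationGame

/-! ### The attached graph: adjacency, connectedness and reduction to its core. -/

section Tail

variable {V : Type*} {H : SimpleGraph V} {z : V} {k : ℕ}

theorem attachTail_path_path (a a' : Fin k) (j j' : Fin 5) :
    ((TailVertex.path a j : TailVertex V k) = .path a' j' ∨
        (attachTail H z k).Adj (.path a' j') (.path a j)) ↔
      a = a' ∧ (j = j' ∨ j.val + 1 = j'.val ∨ j'.val + 1 = j.val) := by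
  simp only [attachTail, SimpleGraph.fromRel_adj, tailRel, ne_eq, TailVertex.path.injEq]
  grind

theorem attachTail_path_iff (w : TailVertex V k) (hw : ∀ a j, w ≠ .path a j)
    (a : Fin k) (j : Fin 5) :
    (TailVertex.path a j = w ∨ (attachTail H z k).Adj w (.path a j)) ↔ w = .x ∧ j = 0 := by
  cases w <;> simp [attachTail, tailRel] at hw ⊢

theorem attachTail_connected (hH : H.Connected) : (attachTail H z k).Connected := by
  have hadj : ∀ {a b : TailVertex V k}, a ≠ b → tailRel H z k a b →
      (attachTail H z k).Reachable a b := fun hne h =>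
    SimpleGraph.Adj.reachable ((SimpleGraph.fromRel_adj _ _ _).2 ⟨hne, Or.inl h⟩)
  have hbase : ∀ p, (attachTail H z k).Reachable (.base p) (.base z) := by
    intro p
    let φ : H →g attachTail H z k :=
      ⟨TailVertex.base, fun {a b} h => (SimpleGraph.fromRel_adj _ _ _).2
        ⟨fun he => h.ne (TailVertex.base.inj he), Or.inl h⟩⟩
    exact (hH.preconnected p z).map φ
  have hx : ∀ w, (attachTail H z k).Reachable w .x := by
    intro w
    cases w with
    | base p => exact (hbase p).trans (hadj (by simp) rfl)
    | x => exact SimpleGraph.Reachable.refl _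
    | leaf i => exact (hadj (a := .x) (b := .leaf i) (by simp) trivial).symm
    | mid => exact (hadj (a := .x) (b := .mid) (by simp) trivial).symm
    | v => exact ((hadj (a := .x) (b := .mid) (by simp) trivial).trans
        (hadj (a := .mid) (b := .v) (by simp) trivial)).symm
    | path i j =>
      obtain ⟨j, hj⟩ := j
      induction j with
      | zero => exact (hadj (a := .x) (b := .path i ⟨0, hj⟩) (by simp) rfl).symm
      | succ j ih =>
        exact (hadj (a := .path i ⟨j, by omega⟩) (b := .path i ⟨j + 1, hj⟩) (by simp)
        ⟨rfl, rfl⟩).symm.trans (ih (by omega))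
  have : Nonempty (TailVertex V k) := ⟨.x⟩
  exact ⟨fun a b => (hx a).trans (hx b).symm⟩

/-- `gameDominationNumber_pathBundle` for a graph embedded into `attachTail H z k`. -/
theorem gameDominationNumber_of_embedding {W : Type*} [Fintype W] [DecidableEq W]
    (G : SimpleGraph W) [DecidableRel G.Adj] (f : G ↪g attachTail H z k) {n : ℕ}
    (q : Fin n → W) (p : Fin k → Fin 5 → W) (hp : ∀ a j, f (p a j) = .path a j)
    (hcover : ∀ w, (∃ i, f w = f (q i)) ∨ ∃ a j, f w = .path a j)
    (hqp : ∀ i a j, f (q i) ≠ .path a j) (hq : ∀ i j, f (q i) = f (q j) → i = j)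
    (N : Fin n → ℕ) (hN : ∀ i j : Fin n, (N i).testBit j = true ↔
      f (q j) = f (q i) ∨ (attachTail H z k).Adj (f (q i)) (f (q j)))
    (hlt : ∀ i, N i < 2 ^ n) (c : Fin n) (hc : f (q c) = .x) {t : ℕ}
    (hle : maskLe (List.ofFn N) (2 ^ n - 1) t .staller (N c) = true)
    (hge : maskLe (List.ofFn N) (2 ^ n - 1) t .dominator (2 ^ c.val) = false) :
    gameDominationNumber G = 2 * k + (t + 1) := by
  -- Pulling adjacency back along `f` treats the full graph (`f` the identity) and the graph without
  -- `v` (`f` the inclusion) at once.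
  have mem_iff : ∀ u w, u ∈ closedNbhd G w ↔ f u = f w ∨ (attachTail H z k).Adj (f w) (f u) := by
    intro u w
    rw [mem_closedNbhd, f.injective.eq_iff, f.map_adj_iff]
  refine gameDominationNumber_pathBundle G (c := c) (q := q) (p := p)
    ?_ ?_ ?_ N ?_ hlt (fun i j h => hq i j (congrArg f h)) hle hge
  · intro w
    simpa only [← hp, f.injective.eq_iff] using hcover w
  · intro a j a' j'
    rw [mem_iff, hp, hp]
    exact attachTail_path_path a a' j j'
  · intro i a j
    have hi : i = c ↔ f (q i) = .x := by
      rw [← hc]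
      exact ⟨fun h => h ▸ rfl, hq i c⟩
    rw [mem_iff, hp, hi]
    exact attachTail_path_iff (f (q i)) (hqp i) a j
  · intro i j
    rw [mem_iff]
    exact hN i j

end Tail

/-! ### The two families and their finite computations. -/

section Families

variable (k : ℕ)

/-- The vertices of `familyZ k` off the attached paths. -/
def verticesZ : Fin 14 → TailVertex (Fin 9) k :=
  ![.base 0, .base 1, .base 2, .base 3, .base 4, .base 5, .base 6, .base 7, .base 8,
    .x, .leaf 0, .leaf 1, .mid, .v]

/-- The closed neighbourhoods of the vertices `verticesZ k i`, as bit masks. -/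
def masksZ : Fin 14 → ℕ :=
  ![35, 71, 142, 284, 408, 97, 226, 468, 920, 7936, 1536, 2560, 12800, 12288]

/-- The closed neighbourhoods, as bit masks, after the removal of `v`. -/
def masksZDelete : Fin 13 → ℕ :=
  ![35, 71, 142, 284, 408, 97, 226, 468, 920, 7936, 1536, 2560, 4608]

/-- The vertices of `familyW k` off the attached paths. -/
def verticesW : Fin 11 → TailVertex (Fin 6) k :=
  ![.base 0, .base 1, .base 2, .base 3, .base 4, .base 5, .x, .leaf 0, .leaf 1, .mid, .v]

/-- The closed neighbourhoods of the vertices `verticesW k i`, as bit masks. -/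
def masksW : Fin 11 → ℕ :=
  ![99, 7, 14, 28, 56, 49, 961, 192, 320, 1600, 1536]

/-- The closed neighbourhoods, as bit masks, after the removal of `v`. -/
def masksWDelete : Fin 10 → ℕ :=
  ![99, 7, 14, 28, 56, 49, 961, 192, 320, 576]

theorem graphZ_connected : graphZ.Connected := by
  have h : ∀ i j : Fin 9, (i, j) ∈ edgesZ → graphZ.Reachable i j := by
    intro i j hij
    by_cases hne : i = j
    · exact hne ▸ SimpleGraph.Reachable.refl _
    · exact SimpleGraph.Adj.reachable ((SimpleGraph.fromRel_adj _ _ _).2 ⟨hne, Or.inl hij⟩)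
  have h1 := h 0 1 (by decide)
  have h2 := h1.trans (h 1 2 (by decide))
  have h3 := h2.trans (h 2 3 (by decide))
  have h8 := h3.trans (h 3 8 (by decide))
  have h7 := h8.trans (h 8 7 (by decide))
  have h6 := h7.trans (h 7 6 (by decide))
  have h5 := h6.trans (h 6 5 (by decide))
  have h4 := h7.trans (h 7 4 (by decide))
  have h0 : ∀ i, graphZ.Reachable 0 i := by
    intro i
    fin_cases i
    exacts [SimpleGraph.Reachable.refl _, h1, h2, h3, h4, h5, h6, h7, h8]
  exact ⟨fun i j => (h0 i).symm.trans (h0 j)⟩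

theorem familyZ_connected : (familyZ k).Connected :=
  attachTail_connected graphZ_connected

theorem familyW_connected : (familyW k).Connected :=
  attachTail_connected SimpleGraph.cycleGraph_connected

theorem verticesZ_cover (w : TailVertex (Fin 9) k) :
    (∃ i, w = verticesZ k i) ∨ ∃ a j, w = .path a j := by
  cases w with
  | base p => exact Or.inl ⟨p.castLE (by omega), by fin_cases p <;> rfl⟩
  | x => exact Or.inl ⟨9, rfl⟩
  | leaf i => exact Or.inl ⟨10 + i.castLE (by omega), by fin_cases i <;> rfl⟩
  | mid => exact Or.inl ⟨12, rfl⟩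
  | v => exact Or.inl ⟨13, rfl⟩
  | path a j => exact Or.inr ⟨a, j, rfl⟩

theorem verticesW_cover (w : TailVertex (Fin 6) k) :
    (∃ i, w = verticesW k i) ∨ ∃ a j, w = .path a j := by
  cases w with
  | base p => exact Or.inl ⟨p.castLE (by omega), by fin_cases p <;> rfl⟩
  | x => exact Or.inl ⟨6, rfl⟩
  | leaf i => exact Or.inl ⟨7 + i.castLE (by omega), by fin_cases i <;> rfl⟩
  | mid => exact Or.inl ⟨9, rfl⟩
  | v => exact Or.inl ⟨10, rfl⟩
  | path a j => exact Or.inr ⟨a, j, rfl⟩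

theorem verticesZ_ne_path (i : Fin 14) (a : Fin k) (j : Fin 5) :
    verticesZ k i ≠ .path a j := by
  fin_cases i <;> exact fun h => nomatch h

theorem verticesW_ne_path (i : Fin 11) (a : Fin k) (j : Fin 5) :
    verticesW k i ≠ .path a j := by
  fin_cases i <;> exact fun h => nomatch h

/-- Here `t = 5`, and `9` is the position of `x` in `verticesZ`. Adjacency within the core does not
depend on `k`, so the masks can be verified with `k` symbolic. -/
theorem gameDominationNumber_familyZ : gameDominationNumber (familyZ k) = 2 * k + 6 :=
  gameDominationNumber_of_embedding (familyZ k) SimpleGraph.Embedding.refl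
    (verticesZ k) TailVertex.path (fun _ _ => rfl) (verticesZ_cover k) (verticesZ_ne_path k)
    (of_decide_eq_true rfl) masksZ (of_decide_eq_true rfl) (by decide) 9 rfl
    (by decide +kernel) (by decide +kernel)

theorem gameDominationNumber_familyW : gameDominationNumber (familyW k) = 2 * k + 5 :=
  gameDominationNumber_of_embedding (familyW k) SimpleGraph.Embedding.refl
    (verticesW k) TailVertex.path (fun _ _ => rfl) (verticesW_cover k) (verticesW_ne_path k)
    (of_decide_eq_true rfl) masksW (of_decide_eq_true rfl) (by decide) 6 rfl
    (by decide +kernel) (by decide +kernel)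

theorem verticesZ_castSucc_ne_v : ∀ i : Fin 13, verticesZ k i.castSucc ≠ .v :=
  of_decide_eq_true rfl

theorem verticesW_castSucc_ne_v : ∀ i : Fin 10, verticesW k i.castSucc ≠ .v :=
  of_decide_eq_true rfl

/-- Since `v` is listed last, `Fin.castSucc` enumerates the remaining core; now `t = 3`. -/
theorem gameDominationNumber_familyZ_delete :
    gameDominationNumber ((familyZ k).induce {TailVertex.v}ᶜ) = 2 * k + 4 := by
  refine gameDominationNumber_of_embedding _ (SimpleGraph.Embedding.induce {TailVertex.v}ᶜ)
    (fun i => ⟨verticesZ k (Fin.castSucc i), verticesZ_castSucc_ne_v k i⟩)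
    (fun a j => ⟨.path a j, fun h => nomatch h⟩) (fun _ _ => rfl) ?_
    (fun i => verticesZ_ne_path k i.castSucc)
    (of_decide_eq_true rfl) masksZDelete (of_decide_eq_true rfl) (by decide) 9 rfl
    (by decide +kernel) (by decide +kernel)
  rintro ⟨w, hw⟩
  refine (verticesZ_cover k w).imp_left ?_
  rintro ⟨i, rfl⟩
  induction i using Fin.lastCases with
  | last => exact absurd rfl hw
  | cast i => exact ⟨i, rfl⟩

theorem gameDominationNumber_familyW_delete :
    gameDominationNumber ((familyW k).induce {TailVertex.v}ᶜ) = 2 * k + 3 := by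
  refine gameDominationNumber_of_embedding _ (SimpleGraph.Embedding.induce {TailVertex.v}ᶜ)
    (fun i => ⟨verticesW k (Fin.castSucc i), verticesW_castSucc_ne_v k i⟩)
    (fun a j => ⟨.path a j, fun h => nomatch h⟩) (fun _ _ => rfl) ?_
    (fun i => verticesW_ne_path k i.castSucc)
    (of_decide_eq_true rfl) masksWDelete (of_decide_eq_true rfl) (by decide) 6 rfl
    (by decide +kernel) (by decide +kernel)
  rintro ⟨w, hw⟩
  refine (verticesW_cover k w).imp_left ?_
  rintro ⟨i, rfl⟩
  induction i using Fin.lastCases with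
  | last => exact absurd rfl hw
  | cast i => exact ⟨i, rfl⟩

end Families

/-! ### Excluding the pairs `(4, 2)` and `(3, 1)`. -/

section SmallValues

variable {V : Type*} [Fintype V] [DecidableEq V] (G : SimpleGraph V) [DecidableRel G.Adj] (v : V)

theorem mem_closedNbhd_induce {s : Set V} [Fintype s] [DecidableEq s]
    [DecidableRel (G.induce s).Adj] (u w : s) :
    u ∈ closedNbhd (G.induce s) w ↔ u.1 ∈ closedNbhd G w.1 := by
  simp [mem_closedNbhd, Subtype.ext_iff]

/-- A vertex `u` dominating `G - v` leaves at most `v` undominated in `G`, so any further move ends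
the game. -/
theorem gameDominationNumber_le_two_of_delete [Fintype ({v}ᶜ : Set V)]
    [DecidableEq ({v}ᶜ : Set V)] [DecidableRel (G.induce {v}ᶜ).Adj]
    (h : gameDominationNumber (G.induce {v}ᶜ) = 1) : gameDominationNumber G ≤ 2 := by
  have hne : (∅ : Finset ({v}ᶜ : Set V)) ≠ Finset.univ := by
    intro he
    rw [gameDominationNumber, he, movesLeft_univ] at h
    omega
  obtain ⟨u, -, hu⟩ := exists_movesLeft_dominator (G.induce {v}ᶜ) hne
  rw [gameDominationNumber] at h
  have hu0 := (movesLeft_eq_zero_iff (G.induce {v}ᶜ)).1 (Nat.succ_injective (hu.symm.trans h))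
  have hdom : ∀ y, y ≠ v → y ∈ closedNbhd G u.1 := by
    intro y hy
    have : (⟨y, hy⟩ : ({v}ᶜ : Set V)) ∈ ∅ ∪ closedNbhd (G.induce {v}ᶜ) u :=
      hu0 ▸ Finset.mem_univ _
    rw [Finset.empty_union, mem_closedNbhd_induce] at this
    exact this
  have hl : u.1 ∈ legalMoves G ∅ :=
    (mem_legalMoves G).2 fun hs => Finset.notMem_empty _ (hs (self_mem_closedNbhd G u.1))
  refine (movesLeft_dominator_le G hl).trans (Nat.succ_le_succ ?_)
  by_cases hD : ∅ ∪ closedNbhd G u.1 = Finset.univ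
  · rw [hD, movesLeft_univ]
    exact Nat.zero_le _
  refine (movesLeft_eq_one G hD (fun w hw => ?_) _).le
  obtain ⟨y, hy, hyu⟩ := Finset.not_subset.1 ((mem_legalMoves G).1 hw)
  rw [Finset.empty_union] at hyu ⊢
  have hyv : y = v := by
    by_contra hyv
    exact hyu (hdom y hyv)
  refine Finset.eq_univ_iff_forall.2 fun a => ?_
  by_cases ha : a = v
  · exact Finset.mem_union_right _ (ha ▸ hyv ▸ hy)
  · exact Finset.mem_union_left _ (hdom a ha)

theorem gameDominationNumber_le_three_of_delete [Fintype ({v}ᶜ : Set V)]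
    [DecidableEq ({v}ᶜ : Set V)] [DecidableRel (G.induce {v}ᶜ).Adj]
    (h : gameDominationNumber (G.induce {v}ᶜ) = 2) : gameDominationNumber G ≤ 3 := by
  have hne : (∅ : Finset ({v}ᶜ : Set V)) ≠ Finset.univ := by
    intro he
    rw [gameDominationNumber, he, movesLeft_univ] at h
    omega
  obtain ⟨u, -, hu⟩ := exists_movesLeft_dominator (G.induce {v}ᶜ) hne
  rw [gameDominationNumber] at h
  rw [h, Finset.empty_union] at hu
  have hu1 : movesLeft (G.induce {v}ᶜ) .staller (closedNbhd (G.induce {v}ᶜ) u) = 1 := by omega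
  have hne' : closedNbhd (G.induce {v}ᶜ) u ≠ Finset.univ := by
    intro he
    rw [he, movesLeft_univ] at hu1
    omega
  -- After `u`, every Staller move in `G - v` must finish it.
  have hA : ∀ w, w ≠ v → ∀ y, y ≠ v → y ∈ closedNbhd G w → y ∉ closedNbhd G u.1 →
      ∀ a, a ≠ v → a ∈ closedNbhd G u.1 ∪ closedNbhd G w := by
    intro w hw y hy hyw hyu a ha
    have hl : (⟨w, hw⟩ : ({v}ᶜ : Set V)) ∈
        legalMoves (G.induce {v}ᶜ) (closedNbhd (G.induce {v}ᶜ) u) := by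
      rw [mem_legalMoves]
      intro hs
      exact hyu ((mem_closedNbhd_induce G _ _).1
        (hs ((mem_closedNbhd_induce G ⟨y, hy⟩ ⟨w, hw⟩).2 hyw)))
    have h0 := (movesLeft_staller_le_iff (G.induce {v}ᶜ) hne' 0).1 hu1.le _ hl
    have h1 := (movesLeft_eq_zero_iff (G.induce {v}ᶜ)).1 (Nat.le_zero.1 h0)
    have h2 : (⟨a, ha⟩ : ({v}ᶜ : Set V)) ∈ closedNbhd (G.induce {v}ᶜ) u ∪
        closedNbhd (G.induce {v}ᶜ) ⟨w, hw⟩ := h1 ▸ Finset.mem_univ _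
    rw [Finset.mem_union, mem_closedNbhd_induce, mem_closedNbhd_induce] at h2
    exact Finset.mem_union.2 h2
  obtain ⟨⟨y₀, hy₀⟩, hy₀u⟩ : ∃ y, y ∉ closedNbhd (G.induce {v}ᶜ) u := by
    by_contra! hall
    exact hne' (Finset.eq_univ_iff_forall.2 hall)
  rw [mem_closedNbhd_induce] at hy₀u
  have hl : u.1 ∈ legalMoves G ∅ :=
    (mem_legalMoves G).2 fun hs => Finset.notMem_empty _ (hs (self_mem_closedNbhd G u.1))
  refine (movesLeft_dominator_le G hl).trans (Nat.succ_le_succ ?_)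
  rw [Finset.empty_union]
  refine (movesLeft_staller_le_iff G (fun he => hy₀u (by simp [he])) 1).2 fun w hw => ?_
  -- If Staller's move dominates `v`, Dominator finishes `G - v` with `y₀`. Otherwise it dominates
  -- something new in `G - v`, hence finishes that graph by `hA`, and Dominator can play `v` if
  -- anything remains.
  by_cases hvw : v ∈ closedNbhd G w
  · refine movesLeft_dominator_le_one G (v := y₀) (Finset.eq_univ_iff_forall.2 fun a => ?_)
    by_cases ha : a = v
    · exact Finset.mem_union_left _ (Finset.mem_union_right _ (ha ▸ hvw))
    · exact Finset.union_subset_union_left Finset.subset_union_left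
        (hA y₀ hy₀ y₀ hy₀ (self_mem_closedNbhd G y₀) hy₀u a ha)
  · obtain ⟨y, hy, hyu⟩ := Finset.not_subset.1 ((mem_legalMoves G).1 hw)
    refine movesLeft_dominator_le_one G (v := v) (Finset.eq_univ_iff_forall.2 fun a => ?_)
    by_cases ha : a = v
    · exact Finset.mem_union_right _ (ha ▸ self_mem_closedNbhd G a)
    · refine Finset.mem_union_left _ (hA w ?_ y ?_ hy hyu a ha)
      · rintro rfl
        exact hvw (self_mem_closedNbhd G w)
      · rintro rfl
        exact hvw hy

end SmallValues

end DominationGame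

theorem mainTheorem6 :
    -- the main assertion; `G.induce {v}ᶜ` is `G - v`
    (∀ ℓ : ℕ, 5 ≤ ℓ →
      ∃ (V : Type) (_ : Fintype V) (_ : DecidableEq V) (G : SimpleGraph V)
        (_ : DecidableRel G.Adj) (v : V),
        G.Connected ∧
        DominationGame.gameDominationNumber G = ℓ ∧
        DominationGame.gameDominationNumber (G.induce {v}ᶜ) = ℓ - 2) ∧
    -- the witnesses for even `ℓ`
    (∀ k : ℕ,
      (DominationGame.familyZ k).Connected ∧
      DominationGame.gameDominationNumber (DominationGame.familyZ k) = 2 * k + 6 ∧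
      DominationGame.gameDominationNumber
        ((DominationGame.familyZ k).induce {DominationGame.TailVertex.v}ᶜ) = 2 * k + 4) ∧
    -- the witnesses for odd `ℓ`
    (∀ k : ℕ,
      (DominationGame.familyW k).Connected ∧
      DominationGame.gameDominationNumber (DominationGame.familyW k) = 2 * k + 5 ∧
      DominationGame.gameDominationNumber
        ((DominationGame.familyW k).induce {DominationGame.TailVertex.v}ᶜ) = 2 * k + 3) ∧
    -- the values `(4, 2)` and `(3, 1)` do not occur
    (∀ (V : Type*) [Fintype V] [DecidableEq V] (G : SimpleGraph V) [DecidableRel G.Adj] (v : V),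
      ¬ (DominationGame.gameDominationNumber G = 4 ∧
          DominationGame.gameDominationNumber (G.induce {v}ᶜ) = 2) ∧
      ¬ (DominationGame.gameDominationNumber G = 3 ∧
          DominationGame.gameDominationNumber (G.induce {v}ᶜ) = 1)) := by
  refine ⟨?_, fun k => ⟨DominationGame.familyZ_connected k,
      DominationGame.gameDominationNumber_familyZ k,
      DominationGame.gameDominationNumber_familyZ_delete k⟩,
    fun k => ⟨DominationGame.familyW_connected k,
      DominationGame.gameDominationNumber_familyW k,
      DominationGame.gameDominationNumber_familyW_delete k⟩, ?_⟩
  · intro ℓ hℓ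
    -- Even `ℓ = 2 * k + 6` is realised by `familyZ k`, odd `ℓ = 2 * k + 5` by `familyW k`.
    obtain ⟨m, rfl | rfl⟩ := Nat.even_or_odd' ℓ
    · obtain ⟨k, rfl⟩ : ∃ k, m = k + 3 := ⟨m - 3, by omega⟩
      refine ⟨_, inferInstance, inferInstance, DominationGame.familyZ k, inferInstance,
        DominationGame.TailVertex.v, DominationGame.familyZ_connected k, ?_, ?_⟩
      · rw [DominationGame.gameDominationNumber_familyZ]
        ring
      · exact (DominationGame.gameDominationNumber_familyZ_delete k).trans (by omega)
    · obtain ⟨k, rfl⟩ : ∃ k, m = k + 2 := ⟨m - 2, by omega⟩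
      refine ⟨_, inferInstance, inferInstance, DominationGame.familyW k, inferInstance,
        DominationGame.TailVertex.v, DominationGame.familyW_connected k, ?_, ?_⟩
      · rw [DominationGame.gameDominationNumber_familyW]
        ring
      · exact (DominationGame.gameDominationNumber_familyW_delete k).trans (by omega)
  · intro V _ _ G _ v
    refine ⟨fun h => ?_, fun h => ?_⟩
    · have := DominationGame.gameDominationNumber_le_three_of_delete G v h.2
      omega
    · have := DominationGame.gameDominationNumber_le_two_of_delete G v h.2
      omega
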